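/- Let $N\in\mathbb N$, let $\mathbf R\in\mathbb C^{N\times N}$ be a nonzero Hermitian positive semidefinite matrix, and let $\mathbf h\sim\mathcal{CN}(\mathbf 0,\mathbf R)$ be a random vector in $\mathbb C^N$, that is, $\mathbf h$ has the law of $\mathbf R^{1/2}\mathbf z$, where the coordinates of $\mathbf z$ are i.i.d. $\mathcal{CN}(0,1)$ (independent real and imaginary parts, each of law $\mathcal N(0,1/2)$). Let $r$ be the rank of $\mathbf R$, let $\lambda_1,\dots,\lambda_r>0$ be its positive eigenvalues, listed with multiplicity, and let $\lambda_{\min}=\min_i\lambda_i$. Write $\Gamma$ for the Gamma function and $\Upsilon(s,x)=\int_0^x t^{s-1}e^{-t}\,dt$ for the lower incomplete Gamma function, and define $\psi_0=1$ and, for $k\ge 0$, $$\psi_{k+1}=\sum_{i=1}^{k+1}\Bigl[\sum_{j=1}^{r}\Bigl(1-\frac{\lambda_{\min}}{\lambda_j}\Bigr)^{i}\Bigr]\frac{\psi_{k+1-i}}{k+1}.$$ Then the following hold. (a) There are independent random variables $E_1,\dots,E_r$, defined on the same probability space as $\mathbf h$ and each exponentially distributed with mean $1$, such that $\|\mathbf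 h\|^2=\sum_{i=1}^r\lambda_iE_i$ almost surely. (b) $\|\mathbf h\|^2$ has a probability density with respect to Lebesgue measure. It is given for almost every $x$ by $$f(x)=\frac{\lambda_{\min}^{r}}{\prod_{i=1}^r\lambda_i}\sum_{k=0}^\infty\frac{\psi_k\,x^{r+k-1}}{\lambda_{\min}^{r+k}\,\Gamma(r+k)}\,e^{-x/\lambda_{\min}}\quad(x\ge 0),\qquad f(x)=0\quad(x<0),$$ and the series converges for every $x\ge 0$. (c) The cumulative distribution function of $\|\mathbf h\|^2$ vanishes for $x<0$, and for every $x\ge 0$ it equals $$F(x)=\frac{\lambda_{\min}^{r}}{\prod_{i=1}^r\lambda_i}\sum_{k=0}^\infty\frac{\psi_k\,\Upsilon(k+r,\,x/\lambda_{\min})}{\Gamma(r+k)},$$ where the series converges. (d) For every transmit power $p>0$, noise variance $\sigma^2>0$ and target rate $\mathcal R\ge 0$, with signal-to-noise ratio $\gamma=\frac{p}{\sigma^2}\|\mathbf h\|^2$, the outage probability is $$\Pr\bigl(\log_2(1+\gamma)<\mathcal R\bigr)=\frac{\lambda_{\min}^{r}}{\prod_{i=1}^r\lambda_i}\sum_{k=0}^\infty\frac{\psi_k\,\Upsilon\Bigl(k+r,\frac{2^{\mathcal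 R}-1}{(p/\sigma^2)\,\lambda_{\min}}\Bigr)}{\Gamma(r+k)}.$$ -/

import Mathlib

open MeasureTheory ProbabilityTheory
open scoped BigOperators ComplexOrder

noncomputable section

namespace MISO

/-- The standard complex Gaussian law `CN(0, 1)` on `ℂ`: independent real and imaginary parts,
each of law `N(0, 1/2)`, so that the second absolute moment is `1`. -/
def stdComplexGaussian : Measure ℂ :=
  ((gaussianReal 0 (1 / 2)).prod (gaussianReal 0 (1 / 2))).map
    (fun q : ℝ × ℝ => (⟨q.1, q.2⟩ : ℂ))

/-- The law `CN(0, I)` on `ℂ^N` with its Euclidean norm: i.i.d. `CN(0, 1)` coordinates. -/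
def stdComplexGaussianVec (N : ℕ) : Measure (EuclideanSpace ℂ (Fin N)) :=
  (Measure.pi (fun _ : Fin N => stdComplexGaussian)).map (WithLp.toLp 2)

open scoped MatrixOrder in
/-- The (circularly symmetric) complex Gaussian law `CN(m, R)` on `ℂ^N` with mean `m` and positive
semidefinite covariance matrix `R`: the law of `m + R^{1/2} z` with `z ∼ CN(0, I)`, where `R^{1/2}`
is the positive semidefinite square root of `R`. -/
def complexGaussian {N : ℕ} (m : EuclideanSpace ℂ (Fin N)) (R : Matrix (Fin N) (Fin N) ℂ) :
    Measure (EuclideanSpace ℂ (Fin N)) :=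
  (stdComplexGaussianVec N).map (fun z => m + Matrix.toEuclideanCLM (𝕜 := ℂ) (CFC.sqrt R) z)

/-- The index set of the positive eigenvalues (with multiplicity) of a positive semidefinite
matrix; it has `R.rank` elements. -/
abbrev PosEigIndex {N : ℕ} {R : Matrix (Fin N) (Fin N) ℂ} (hR : R.PosSemidef) : Type :=
  {i : Fin N // 0 < hR.isHermitian.eigenvalues i}

/-- The positive eigenvalues of a positive semidefinite matrix, listed with multiplicity. -/
def posEig {N : ℕ} {R : Matrix (Fin N) (Fin N) ℂ} (hR : R.PosSemidef) (i : PosEigIndex hR) : ℝ :=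
  hR.isHermitian.eigenvalues i.1

/-- The smallest positive eigenvalue (used only for `R ≠ 0`, so that there is one). -/
def minPosEig {N : ℕ} {R : Matrix (Fin N) (Fin N) ℂ} (hR : R.PosSemidef) : ℝ :=
  ⨅ i : PosEigIndex hR, posEig hR i

/-- The coefficients `ψ_k`. -/
def psi {N : ℕ} {R : Matrix (Fin N) (Fin N) ℂ} (hR : R.PosSemidef) : ℕ → ℝ
  | 0 => 1
  | k + 1 => ∑ i : Fin (k + 1),
      (∑ j : PosEigIndex hR, (1 - minPosEig hR / posEig hR j) ^ (i.1 + 1)) *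
        (psi hR (k - i.1) / ((k : ℝ) + 1))
  termination_by k => k
  decreasing_by omega

theorem psi_zero {N : ℕ} {R : Matrix (Fin N) (Fin N) ℂ} (hR : R.PosSemidef) : psi hR 0 = 1 := by
  rw [psi]

/-- The recursion for `ψ_k`, with the summation index running over `1, …, k + 1`. -/
theorem psi_succ {N : ℕ} {R : Matrix (Fin N) (Fin N) ℂ} (hR : R.PosSemidef) (k : ℕ) :
    psi hR (k + 1) = ∑ i ∈ Finset.Icc 1 (k + 1),
      (∑ j : PosEigIndex hR, (1 - minPosEig hR / posEig hR j) ^ i) *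
        (psi hR (k + 1 - i) / ((k : ℝ) + 1)) := by
  rw [psi]
  refine Finset.sum_bij (fun i _ => i.1 + 1) ?_ ?_ ?_ ?_
  · intro i _
    simp only [Finset.mem_Icc]
    omega
  · intro i _ j _ hij
    exact Fin.ext (by omega)
  · intro b hb
    simp only [Finset.mem_Icc] at hb
    exact ⟨⟨b - 1, by omega⟩, Finset.mem_univ _, by simp only; omega⟩
  · intro i _
    rw [Nat.add_sub_add_right]

/-- The lower incomplete Gamma function `Υ(s, x) = ∫_0^x t^(s-1) e^(-t) dt`. -/
def lowerGamma (s x : ℝ) : ℝ :=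
  ∫ t in (0 : ℝ)..x, t ^ (s - 1) * Real.exp (-t)

/-- The factor `λ_min^r / ∏ λ_i`, where `r` is the rank of `R`. -/
def seriesFactor {N : ℕ} {R : Matrix (Fin N) (Fin N) ℂ} (hR : R.PosSemidef) : ℝ :=
  minPosEig hR ^ R.rank / ∏ i : PosEigIndex hR, posEig hR i

/-- The `k`-th term of the series in the density. -/
def pdfTerm {N : ℕ} {R : Matrix (Fin N) (Fin N) ℂ} (hR : R.PosSemidef) (x : ℝ) (k : ℕ) : ℝ :=
  psi hR k * x ^ (R.rank + k - 1) /
    (minPosEig hR ^ (R.rank + k) * Real.Gamma ((R.rank : ℝ) + k)) *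
    Real.exp (-(x / minPosEig hR))

/-- The `k`-th term of the series in the distribution function, as a function of the second
argument `y = x / λ_min` of the incomplete Gamma function. -/
def cdfTerm {N : ℕ} {R : Matrix (Fin N) (Fin N) ℂ} (hR : R.PosSemidef) (y : ℝ) (k : ℕ) : ℝ :=
  psi hR k * lowerGamma ((k : ℝ) + R.rank) y / Real.Gamma ((R.rank : ℝ) + k)

/-- The claimed density of the channel gain (zero on the negative half-line). -/
def gainPDF {N : ℕ} {R : Matrix (Fin N) (Fin N) ℂ} (hR : R.PosSemidef) (x : ℝ) : ℝ :=
  if 0 ≤ x then seriesFactor hR * ∑' k : ℕ, pdfTerm hR x k else 0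

/-- The received signal-to-noise ratio `γ = (p / σ²) ‖h‖²`. -/
def snr {N : ℕ} (p σ : ℝ) (h : EuclideanSpace ℂ (Fin N)) : ℝ :=
  p / σ ^ 2 * ‖h‖ ^ 2

/-- The outage probability `Pr(log₂(1 + γ) < rate)` of the random channel `h`. -/
def outageProb {Ω : Type*} [MeasurableSpace Ω] (P : Measure Ω) {N : ℕ}
    (h : Ω → EuclideanSpace ℂ (Fin N)) (p σ rate : ℝ) : ℝ :=
  P.real {ω | Real.logb 2 (1 + snr p σ (h ω)) < rate}

end MISO

end

noncomputable section

namespace MISO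

/-! In an eigenbasis of the covariance the coordinates of `h` are independent complex Gaussians with
variances the eigenvalues, and a standard complex Gaussian has squared modulus of law Exp(1). Hence
the gain is a sum of `λ_j E_j`, with characteristic function `∏ 1 / (1 - i λ_j t)`.

The series comes from rewriting this product. Put `a_j = 1 - λ_min / λ_j`, which lies in `[0, 1)`,
and `u = 1 / (1 - i λ_min t)`. Then `1 - a_j u = (λ_min / λ_j) u (1 - i λ_j t)`, so the product
equals `C u^r ∏ 1 / (1 - a_j u)` with `C = ∏ λ_min / λ_j`. The `ψ_k` are the Taylor coefficients of
`∏ 1 / (1 - a_j X)` (Newton's recursion), which gives `C ∑ ψ_k u^(r+k)`. Since `u^(r+k)` is the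
characteristic function of the gamma law of shape `r + k` and rate `1 / λ_min`, the gain is a
mixture of these laws with weights `C ψ_k`, nonnegative and of sum one (take `u = 1`). Density and
distribution function are then summed termwise.

The main lemmas are `exists_exponential_representation`, `psi_eq_coeff_geomProd`,
`charFun_gainMeasure` and `map_sq_norm_eq_gainMeasure`. -/

/-! ### Characteristic functions of gamma, exponential and complex Gaussian laws. -/

theorem tendsto_pow_mul_cexp_neg_mul_atTop (n : ℕ) {c : ℂ} (hc : 0 < c.re) :
    Filter.Tendsto (fun x : ℝ => (x : ℂ) ^ n * Complex.exp (-(c * x))) Filter.atTop (nhds 0) := by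
  rw [tendsto_zero_iff_norm_tendsto_zero]
  have h := tendsto_rpow_mul_exp_neg_mul_atTop_nhds_zero (n : ℝ) c.re hc
  refine h.congr' ?_
  filter_upwards [Filter.eventually_ge_atTop 0] with x hx
  simp [Complex.norm_exp, abs_of_nonneg hx]

theorem integrableOn_pow_mul_cexp_neg_mul (n : ℕ) {c : ℂ} (hc : 0 < c.re) :
    IntegrableOn (fun x : ℝ => (x : ℂ) ^ n * Complex.exp (-(c * x))) (Set.Ioi 0) := by
  have h : IntegrableOn (fun x : ℝ => x ^ (n : ℝ) * Real.exp (-c.re * x ^ (1 : ℝ))) (Set.Ioi 0) :=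
    integrableOn_rpow_mul_exp_neg_mul_rpow (by linarith [n.cast_nonneg (α := ℝ)]) one_pos hc
  refine Integrable.mono' h (by fun_prop) ?_
  filter_upwards [ae_restrict_mem measurableSet_Ioi] with x hx
  simp [Complex.norm_exp, abs_of_pos (Set.mem_Ioi.1 hx)]

/-- Integration by parts in inductive form: `x^(n+1) e^(-cx)` vanishes at `0` and at infinity, so
its derivative has integral zero, which relates exponents `n` and `n + 1`. -/
theorem integral_pow_mul_cexp_neg_mul (n : ℕ) {c : ℂ} (hc : 0 < c.re) :
    ∫ x in Set.Ioi (0 : ℝ), (x : ℂ) ^ n * Complex.exp (-(c * x)) = n.factorial / c ^ (n + 1) := by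
  have hc0 : c ≠ 0 := fun h => by simp [h] at hc
  have hexp : ∀ x : ℝ, HasDerivAt (fun y : ℝ => Complex.exp (-(c * y)))
      (-c * Complex.exp (-(c * x))) x := fun x => by
    have := ((((hasDerivAt_id x).ofReal_comp).const_mul c).neg).cexp
    simpa [mul_comm] using this
  induction n with
  | zero =>
    have h := integral_exp_mul_complex_Ioi (a := -c) (by simpa) 0
    simp only [neg_mul] at h
    simp [h, neg_div_neg_eq]
  | succ n ih =>
    have hder : ∀ x ∈ Set.Ioi (0 : ℝ), HasDerivAt
        (fun y : ℝ => (y : ℂ) ^ (n + 1) * Complex.exp (-(c * y)))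
        ((n + 1) * ((x : ℂ) ^ n * Complex.exp (-(c * x))) -
          c * ((x : ℂ) ^ (n + 1) * Complex.exp (-(c * x)))) x := fun x _ => by
      have := (((hasDerivAt_id x).ofReal_comp).pow (n + 1)).mul (hexp x)
      refine this.congr_deriv ?_
      simp
      ring
    have h1 := (integrableOn_pow_mul_cexp_neg_mul n hc).const_mul ((n : ℂ) + 1)
    have h2 := (integrableOn_pow_mul_cexp_neg_mul (n + 1) hc).const_mul c
    have h := integral_Ioi_of_hasDerivAt_of_tendsto (by fun_prop) hder (h1.sub h2)
      (tendsto_pow_mul_cexp_neg_mul_atTop (n + 1) hc)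
    rw [integral_sub h1 h2, integral_const_mul, integral_const_mul, ih] at h
    simp only [Complex.ofReal_zero, ne_eq, Nat.add_eq_zero_iff, one_ne_zero, and_false,
      not_false_eq_true, zero_pow, zero_mul, sub_zero] at h
    rw [eq_div_iff (pow_ne_zero _ hc0), Nat.factorial_succ]
    have h' := (sub_eq_zero.1 h).symm
    field_simp at h'
    push_cast
    linear_combination h'

theorem measurable_gammaPDF (a r : ℝ) : Measurable (gammaPDF a r) :=
  ENNReal.measurable_ofReal.comp (measurable_gammaPDFReal a r)

/-- The characteristic function of a gamma law with integer shape. -/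
theorem charFun_gammaMeasure_natCast {n : ℕ} (hn : 0 < n) {r : ℝ} (hr : 0 < r) (t : ℝ) :
    charFun (gammaMeasure n r) t = (r / (r - t * Complex.I)) ^ n := by
  obtain ⟨m, rfl⟩ : ∃ m, n = m + 1 := ⟨n - 1, by omega⟩
  rw [charFun_apply_real, gammaMeasure,
    integral_withDensity_eq_integral_toReal_smul (measurable_gammaPDF _ _)
      (ae_of_all _ fun _ => by exact ENNReal.ofReal_lt_top)]
  have key : ∀ x : ℝ, (gammaPDF (m + 1 : ℕ) r x).toReal • Complex.exp (t * x * Complex.I) =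
      (Set.Ici 0).indicator (fun x : ℝ => (r : ℂ) ^ (m + 1) / m.factorial *
        ((x : ℂ) ^ m * Complex.exp (-((r - t * Complex.I) * x)))) x := fun x => by
    rw [gammaPDF, ENNReal.toReal_ofReal (gammaPDFReal_nonneg (by positivity) hr x), gammaPDFReal]
    by_cases hx : 0 ≤ x
    · rw [if_pos hx, Set.indicator_of_mem (Set.mem_Ici.2 hx), Real.rpow_natCast]
      have e : ((m + 1 : ℕ) : ℝ) - 1 = m := by push_cast; ring
      rw [e, Real.rpow_natCast, Nat.cast_succ, Real.Gamma_nat_eq_factorial]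
      rw [show -((r - t * Complex.I) * x) = -((r : ℂ) * x) + t * x * Complex.I by ring,
        Complex.exp_add, Complex.real_smul]
      push_cast
      ring
    · rw [if_neg hx, Set.indicator_of_notMem (by simpa using hx), zero_smul]
  simp_rw [key]
  rw [integral_indicator measurableSet_Ici, integral_Ici_eq_integral_Ioi, integral_const_mul,
    integral_pow_mul_cexp_neg_mul m (by simpa)]
  have := Nat.factorial_ne_zero m
  rw [div_pow]
  field_simp

theorem charFun_expMeasure_one (t : ℝ) :
    charFun (expMeasure 1) t = 1 / (1 - t * Complex.I) := by
  simpa [expMeasure] using charFun_gammaMeasure_natCast one_pos one_pos t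

/-- The integral itself involves a complex square root. Real and imaginary parts contribute equal
factors, so only the square is needed and no branch has to be tracked. -/
theorem sq_integral_cexp_mul_sq_gaussianReal_half (t : ℝ) :
    (∫ x, Complex.exp (t * (x : ℂ) ^ 2 * Complex.I) ∂(gaussianReal 0 (1 / 2))) ^ 2 =
      1 / (1 - t * Complex.I) := by
  rw [integral_gaussianReal_eq_integral_smul (by norm_num)]
  have hpi : (2 * Real.pi * ((1 / 2 : NNReal) : ℝ)) = Real.pi := by push_cast; ring
  have key : ∀ x : ℝ, gaussianPDFReal 0 (1 / 2) x • Complex.exp (t * (x : ℂ) ^ 2 * Complex.I) =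
      (√Real.pi : ℂ)⁻¹ * Complex.exp (-(1 - t * Complex.I) * (x : ℂ) ^ 2) := fun x => by
    rw [gaussianPDFReal, Complex.real_smul, hpi]
    push_cast
    rw [show -(1 - (t : ℂ) * Complex.I) * (x : ℂ) ^ 2 =
      -(x : ℂ) ^ 2 + t * (x : ℂ) ^ 2 * Complex.I by ring, Complex.exp_add]
    norm_num
    ring
  simp_rw [key]
  have hs : (√Real.pi : ℂ) ^ 2 = Real.pi := by exact_mod_cast Real.sq_sqrt Real.pi_pos.le
  rw [integral_const_mul, integral_gaussian_complex (by simp), mul_pow, ← Complex.cpow_nat_mul,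
    inv_pow, hs]
  have : (Real.pi : ℂ) ≠ 0 := by exact_mod_cast Real.pi_ne_zero
  norm_num
  field_simp

theorem measurable_complex_mk : Measurable (fun q : ℝ × ℝ => (⟨q.1, q.2⟩ : ℂ)) :=
  Complex.measurableEquivRealProd.symm.measurable

instance : IsProbabilityMeasure stdComplexGaussian :=
  Measure.isProbabilityMeasure_map measurable_complex_mk.aemeasurable

/-- The squared modulus of a standard complex Gaussian variable is a unit exponential variable. -/
theorem map_sq_norm_stdComplexGaussian :
    stdComplexGaussian.map (fun z => ‖z‖ ^ 2) = expMeasure 1 := by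
  have := isProbabilityMeasure_expMeasure one_pos
  have : IsProbabilityMeasure (stdComplexGaussian.map (fun z => ‖z‖ ^ 2)) :=
    Measure.isProbabilityMeasure_map (by fun_prop)
  refine Measure.ext_of_charFun (funext fun t => ?_)
  rw [charFun_expMeasure_one, charFun_apply_real, integral_map (by fun_prop) (by fun_prop),
    stdComplexGaussian, integral_map measurable_complex_mk.aemeasurable (by fun_prop)]
  have e : ∀ q : ℝ × ℝ, Complex.exp (t * (‖(⟨q.1, q.2⟩ : ℂ)‖ ^ 2 : ℝ) * Complex.I) =
      Complex.exp (t * (q.1 : ℂ) ^ 2 * Complex.I) * Complex.exp (t * (q.2 : ℂ) ^ 2 * Complex.I) :=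
    fun q => by
      rw [← Complex.exp_add, ← Complex.normSq_eq_norm_sq, Complex.normSq_mk]
      push_cast
      ring_nf
  simp_rw [e]
  rw [integral_prod_mul (fun x : ℝ => Complex.exp (t * (x : ℂ) ^ 2 * Complex.I))
    (fun x : ℝ => Complex.exp (t * (x : ℂ) ^ 2 * Complex.I)),
    ← pow_two, sq_integral_cexp_mul_sq_gaussianReal_half]

theorem charFun_stdComplexGaussian (t : ℂ) :
    charFun stdComplexGaussian t = Complex.exp (-(‖t‖ ^ 2 / 4 : ℝ)) := by
  rw [charFun_apply, stdComplexGaussian, integral_map measurable_complex_mk.aemeasurable (by fun_prop)]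
  have e : ∀ q : ℝ × ℝ, Complex.exp ((inner ℝ (⟨q.1, q.2⟩ : ℂ) t : ℝ) * Complex.I) =
      Complex.exp (t.re * q.1 * Complex.I) * Complex.exp (t.im * q.2 * Complex.I) := fun q => by
    rw [← Complex.exp_add, Complex.inner]
    simp
    ring_nf
  simp_rw [e]
  rw [integral_prod_mul (fun x : ℝ => Complex.exp (t.re * x * Complex.I))
    (fun x : ℝ => Complex.exp (t.im * x * Complex.I)), ← charFun_apply_real,
    ← charFun_apply_real, charFun_gaussianReal, charFun_gaussianReal, ← Complex.exp_add,
    ← Complex.normSq_eq_norm_sq, Complex.normSq_apply]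
  push_cast
  ring_nf

/-! ### The generating series of the coefficients `ψ_k`. -/

/-- The power series `∏ⱼ 1 / (1 - aⱼ X)`. -/
def geomProd {ι : Type*} (s : Finset ι) (a : ι → ℝ) : PowerSeries ℝ :=
  ∏ j ∈ s, PowerSeries.mk fun k => a j ^ k

theorem derivative_mk_pow (a : ℝ) :
    PowerSeries.derivative ℝ (PowerSeries.mk fun k => a ^ k) =
      (PowerSeries.mk fun k => a ^ k) * PowerSeries.mk fun k => a ^ (k + 1) := by
  ext n
  rw [PowerSeries.coeff_derivative, PowerSeries.coeff_mul, PowerSeries.coeff_mk,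
    Finset.sum_congr rfl (g := fun _ => a ^ (n + 1))]
  · simp; ring
  · intro p hp
    rw [PowerSeries.coeff_mk, PowerSeries.coeff_mk, ← pow_add, ← add_assoc,
      Finset.HasAntidiagonal.mem_antidiagonal.1 hp]

/-- Logarithmic differentiation: each factor `1 / (1 - aX)` has logarithmic derivative `a / (1 -
aX)`, and these add up to the series of power sums. -/
theorem derivative_geomProd {ι : Type*} (s : Finset ι) (a : ι → ℝ) :
    PowerSeries.derivative ℝ (geomProd s a) =
      geomProd s a * PowerSeries.mk fun k => ∑ j ∈ s, a j ^ (k + 1) := by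
  classical
  induction s using Finset.induction_on with
  | empty =>
    have : (PowerSeries.mk fun _ : ℕ => (0 : ℝ)) = 0 := rfl
    simp [geomProd, this]
  | insert i s hi ih =>
    have e : (PowerSeries.mk fun k => ∑ j ∈ insert i s, a j ^ (k + 1)) =
        (PowerSeries.mk fun k => a i ^ (k + 1)) + PowerSeries.mk fun k => ∑ j ∈ s, a j ^ (k + 1) := by
      ext n
      simp [Finset.sum_insert hi]
    rw [geomProd, Finset.prod_insert hi, ← geomProd, Derivation.leibniz, ih, derivative_mk_pow, e,
      smul_eq_mul, smul_eq_mul]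
    ring

theorem coeff_geomProd_zero {ι : Type*} (s : Finset ι) (a : ι → ℝ) :
    PowerSeries.coeff 0 (geomProd s a) = 1 := by
  simp [geomProd, map_prod, PowerSeries.coeff_zero_eq_constantCoeff]

/-- Newton's recursion for the coefficients of `∏ⱼ 1 / (1 - aⱼ X)`. -/
theorem coeff_geomProd_succ {ι : Type*} (s : Finset ι) (a : ι → ℝ) (k : ℕ) :
    PowerSeries.coeff (k + 1) (geomProd s a) = ∑ i ∈ Finset.range (k + 1),
      (∑ j ∈ s, a j ^ (i + 1)) * (PowerSeries.coeff (k - i) (geomProd s a) / ((k : ℝ) + 1)) := by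
  have h := congrArg (PowerSeries.coeff k) (derivative_geomProd s a)
  rw [PowerSeries.coeff_derivative, mul_comm (geomProd s a), PowerSeries.coeff_mul,
    Finset.Nat.sum_antidiagonal_eq_sum_range_succ_mk] at h
  have hk : (k : ℝ) + 1 ≠ 0 := by positivity
  rw [eq_div_iff hk |>.2 h, Finset.sum_div]
  exact Finset.sum_congr rfl fun i _ => by rw [PowerSeries.coeff_mk, mul_div_assoc]

theorem coeff_geomProd_nonneg {ι : Type*} (s : Finset ι) {a : ι → ℝ} (ha : ∀ j, 0 ≤ a j) (k : ℕ) :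
    0 ≤ PowerSeries.coeff k (geomProd s a) := by
  induction k using Nat.strong_induction_on with
  | _ k ih =>
    cases k with
    | zero => rw [coeff_geomProd_zero]; exact zero_le_one
    | succ k =>
      rw [coeff_geomProd_succ]
      refine Finset.sum_nonneg fun i _ => mul_nonneg (Finset.sum_nonneg fun j _ => pow_nonneg (ha j) _)
        (div_nonneg (ih _ (by omega)) (by positivity))

/-- Induction on the factors by Cauchy products. Absolute summability is carried along because the
product formula for two series requires it. -/
theorem summable_norm_and_hasSum_geomProd {ι : Type*} (s : Finset ι) {a : ι → ℝ} {u : ℂ}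
    (hu : ∀ j ∈ s, ‖(a j : ℂ) * u‖ < 1) :
    (Summable fun k => ‖((PowerSeries.coeff k (geomProd s a) : ℝ) : ℂ) * u ^ k‖) ∧
      HasSum (fun k => ((PowerSeries.coeff k (geomProd s a) : ℝ) : ℂ) * u ^ k)
        (∏ j ∈ s, (1 - a j * u)⁻¹) := by
  classical
  induction s using Finset.induction_on with
  | empty =>
    have e : ∀ k, k ≠ 0 → PowerSeries.coeff k (geomProd (∅ : Finset ι) a) = 0 := fun k hk => by
      simp [geomProd, PowerSeries.coeff_one, hk]
    refine ⟨summable_of_ne_finset_zero (s := {0}) fun k hk => ?_, ?_⟩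
    · simp [e k (by simpa using hk)]
    · have := hasSum_single (f := fun k => ((PowerSeries.coeff k (geomProd (∅ : Finset ι) a) : ℝ) : ℂ) * u ^ k)
        0 (fun k hk => by simp [e k hk])
      simpa [geomProd] using this
  | insert i s hi ih =>
    obtain ⟨h1, h2⟩ := ih fun j hj => hu j (Finset.mem_insert_of_mem hj)
    have hi1 := hu i (Finset.mem_insert_self i s)
    have h3 : Summable fun k => ‖((a i : ℂ) * u) ^ k‖ := by
      simpa using summable_geometric_of_lt_one (norm_nonneg _) hi1
    have h4 := hasSum_geometric_of_norm_lt_one hi1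
    have e : ∀ k, ((PowerSeries.coeff k (geomProd (insert i s) a) : ℝ) : ℂ) * u ^ k =
        ∑ p ∈ Finset.HasAntidiagonal.antidiagonal k, ((a i : ℂ) * u) ^ p.1 *
          (((PowerSeries.coeff p.2 (geomProd s a) : ℝ) : ℂ) * u ^ p.2) := fun k => by
      rw [geomProd, Finset.prod_insert hi, ← geomProd, PowerSeries.coeff_mul]
      push_cast
      rw [Finset.sum_mul]
      refine Finset.sum_congr rfl fun p hp => ?_
      rw [PowerSeries.coeff_mk, ← Finset.HasAntidiagonal.mem_antidiagonal.1 hp]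
      push_cast
      ring
    simp_rw [e]
    have h5 := summable_norm_sum_mul_antidiagonal_of_summable_norm h3 h1
    refine ⟨h5, ?_⟩
    rw [Finset.prod_insert hi, ← h4.tsum_eq, ← h2.tsum_eq,
      tsum_mul_tsum_eq_tsum_sum_antidiagonal_of_summable_norm h3 h1]
    exact h5.of_norm.hasSum

/-! ### Positive eigenvalues and the mixture weights. -/

section Eigenvalues

variable {N : ℕ} {R : Matrix (Fin N) (Fin N) ℂ} (hR : R.PosSemidef)

theorem posEig_pos (j : PosEigIndex hR) : 0 < posEig hR j := j.2

theorem nonempty_posEigIndex (hR0 : R ≠ 0) : Nonempty (PosEigIndex hR) := by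
  by_contra h
  refine hR0 ((hR.isHermitian.eigenvalues_eq_zero_iff).1 (funext fun i => ?_))
  exact le_antisymm (not_lt.1 fun hi => h ⟨⟨i, hi⟩⟩) (hR.eigenvalues_nonneg i)

theorem card_posEigIndex : Fintype.card (PosEigIndex hR) = R.rank := by
  rw [hR.isHermitian.rank_eq_card_non_zero_eigs]
  exact Fintype.card_congr (Equiv.subtypeEquivRight fun i =>
    ⟨ne_of_gt, fun h => lt_of_le_of_ne (hR.eigenvalues_nonneg i) h.symm⟩)

theorem rank_pos {N : ℕ} {R : Matrix (Fin N) (Fin N) ℂ} (hR : R.PosSemidef) (hR0 : R ≠ 0) : 0 < R.rank :=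
  card_posEigIndex hR ▸ Fintype.card_pos_iff.2 (nonempty_posEigIndex hR hR0)

theorem minPosEig_pos (hR0 : R ≠ 0) : 0 < minPosEig hR := by
  have := nonempty_posEigIndex hR hR0
  obtain ⟨j, hj⟩ := exists_eq_ciInf_of_finite (f := posEig hR)
  rw [minPosEig, ← hj]
  exact posEig_pos hR j

theorem minPosEig_le (j : PosEigIndex hR) : minPosEig hR ≤ posEig hR j :=
  ciInf_le (Set.finite_range _).bddBelow j

theorem one_sub_minPosEig_div_nonneg (j : PosEigIndex hR) :
    0 ≤ 1 - minPosEig hR / posEig hR j :=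
  sub_nonneg.2 ((div_le_one (posEig_pos hR j)).2 (minPosEig_le hR j))

theorem one_sub_minPosEig_div_lt_one (hR0 : R ≠ 0) (j : PosEigIndex hR) :
    1 - minPosEig hR / posEig hR j < 1 :=
  sub_lt_self _ (div_pos (minPosEig_pos hR hR0) (posEig_pos hR j))

/-- Both sides start at `1` and obey the same Newton recursion. -/
theorem psi_eq_coeff_geomProd (k : ℕ) :
    psi hR k = PowerSeries.coeff k
      (geomProd Finset.univ fun j : PosEigIndex hR => 1 - minPosEig hR / posEig hR j) := by
  induction k using Nat.strong_induction_on with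
  | _ k ih =>
    cases k with
    | zero => rw [coeff_geomProd_zero, psi_zero]
    | succ k =>
      rw [coeff_geomProd_succ, psi, Finset.sum_range]
      exact Finset.sum_congr rfl fun i _ => by rw [ih _ (by omega)]

theorem psi_nonneg (k : ℕ) : 0 ≤ psi hR k := by
  rw [psi_eq_coeff_geomProd]
  exact coeff_geomProd_nonneg _ (one_sub_minPosEig_div_nonneg hR) k

/-- The closed unit disc is allowed because every ratio `1 - λ_min / λ_j` is strictly below one. The
boundary point `u = 1` yields the total mass of the weights. -/
theorem hasSum_psi (hR0 : R ≠ 0) {u : ℂ} (hu : ‖u‖ ≤ 1) :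
    HasSum (fun k => (psi hR k : ℂ) * u ^ k)
      (∏ j : PosEigIndex hR, (1 - (1 - minPosEig hR / posEig hR j : ℝ) * u)⁻¹) := by
  simp only [psi_eq_coeff_geomProd hR]
  refine (summable_norm_and_hasSum_geomProd _ fun j _ => ?_).2
  rw [norm_mul, Complex.norm_real, Real.norm_of_nonneg (one_sub_minPosEig_div_nonneg hR j)]
  exact (mul_le_of_le_one_right (one_sub_minPosEig_div_nonneg hR j) hu).trans_lt
    (one_sub_minPosEig_div_lt_one hR hR0 j)

theorem seriesFactor_eq_prod :
    seriesFactor hR = ∏ j : PosEigIndex hR, (minPosEig hR / posEig hR j) := by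
  rw [seriesFactor, Finset.prod_div_distrib, Finset.prod_const, Finset.card_univ,
    card_posEigIndex]

theorem seriesFactor_pos (hR0 : R ≠ 0) : 0 < seriesFactor hR := by
  rw [seriesFactor_eq_prod]
  exact Finset.prod_pos fun j _ => div_pos (minPosEig_pos hR hR0) (posEig_pos hR j)

/-- The weights `seriesFactor * ψ_k` sum to one. -/
theorem hasSum_seriesFactor_mul_psi (hR0 : R ≠ 0) :
    HasSum (fun k => seriesFactor hR * psi hR k) 1 := by
  have h := (hasSum_psi hR hR0 (u := 1) (by simp)).mul_left (seriesFactor hR : ℂ)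
  have e : (seriesFactor hR : ℂ) *
      ∏ j : PosEigIndex hR, (1 - (1 - minPosEig hR / posEig hR j : ℝ) * (1 : ℂ))⁻¹ = (1 : ℝ) := by
    rw [seriesFactor_eq_prod]
    push_cast
    rw [← Finset.prod_mul_distrib]
    refine Finset.prod_eq_one fun j _ => ?_
    have h1 : (minPosEig hR : ℂ) ≠ 0 := by exact_mod_cast (minPosEig_pos hR hR0).ne'
    have h2 : (posEig hR j : ℂ) ≠ 0 := by exact_mod_cast (posEig_pos hR j).ne'
    field_simp
    simp [h1]
  rw [e] at h
  simp only [one_pow, mul_one] at h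
  exact_mod_cast h

end Eigenvalues

theorem cdf_gammaMeasure_eq_lowerGamma {a r : ℝ} (ha : 0 < a) (hr : 0 < r) {x : ℝ} (hx : 0 ≤ x) :
    cdf (gammaMeasure a r) x = lowerGamma a (r * x) / Real.Gamma a := by
  rw [cdf_gammaMeasure_eq_integral ha hr,
    setIntegral_eq_of_subset_of_forall_sdiff_eq_zero (f := gammaPDFReal a r) measurableSet_Iic
      (Set.Icc_subset_Iic_self (a := 0)) (fun y hy => if_neg fun h0 => hy.2 ⟨h0, hy.1⟩),
    integral_Icc_eq_integral_Ioc, ← intervalIntegral.integral_of_le hx, lowerGamma]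
  have h := intervalIntegral.mul_integral_comp_mul_left (a := 0) (b := x) (c := r)
    (f := fun t : ℝ => t ^ (a - 1) * Real.exp (-t))
  rw [mul_zero] at h
  rw [← h, ← intervalIntegral.integral_const_mul, ← intervalIntegral.integral_div]
  refine intervalIntegral.integral_congr fun y hy => ?_
  rw [Set.uIcc_of_le hx] at hy
  simp only [gammaPDFReal, if_pos hy.1]
  rw [Real.mul_rpow hr.le hy.1, Real.rpow_sub_one hr.ne']
  field_simp

/-! ### The gamma mixture: characteristic function, density, distribution function. -/

section Mixture

variable {N : ℕ} {R : Matrix (Fin N) (Fin N) ℂ} (hR : R.PosSemidef)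

theorem pdfTerm_eq (hR0 : R ≠ 0) {x : ℝ} (hx : 0 ≤ x) (k : ℕ) :
    pdfTerm hR x k = psi hR k * gammaPDFReal (R.rank + k : ℕ) (minPosEig hR)⁻¹ x := by
  have hr := rank_pos hR hR0
  rw [pdfTerm, gammaPDFReal, if_pos hx, Real.rpow_natCast,
    -- The exponent in `pdfTerm` is a truncated subtraction; it agrees with the real one because the
    -- rank is positive.
    show ((R.rank + k : ℕ) : ℝ) - 1 = (R.rank + k - 1 : ℕ) by
      rw [Nat.cast_sub (by omega)]; simp, Real.rpow_natCast, Nat.cast_add, inv_pow,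
    div_eq_inv_mul x]
  field_simp

theorem psi_le (hR0 : R ≠ 0) (k : ℕ) : psi hR k ≤ (seriesFactor hR)⁻¹ := by
  have h := le_hasSum (hasSum_seriesFactor_mul_psi hR hR0) k fun j _ =>
    mul_nonneg (seriesFactor_pos hR hR0).le (psi_nonneg hR j)
  rw [← one_div]
  exact (le_div_iff₀' (seriesFactor_pos hR hR0)).2 h

/-- The `ψ_k` are bounded by `psi_le`, so the terms are dominated by a multiple of the exponential
series at `x / λ_min`, shifted by `r - 1`. -/
theorem summable_pdfTerm (hR0 : R ≠ 0) {x : ℝ} (hx : 0 ≤ x) : Summable (pdfTerm hR x) := by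
  have hr := rank_pos hR hR0
  have hl := minPosEig_pos hR hR0
  have h := (summable_nat_add_iff (R.rank - 1)).2 (Real.summable_pow_div_factorial (x / minPosEig hR))
  refine Summable.of_nonneg_of_le
    (g := fun k => pdfTerm hR x k)
    (f := fun k => ((seriesFactor hR)⁻¹ * (minPosEig hR)⁻¹ * Real.exp (-(x / minPosEig hR))) *
      ((x / minPosEig hR) ^ (k + (R.rank - 1)) / (k + (R.rank - 1)).factorial))
    (fun k => ?_) (fun k => ?_) (h.mul_left _)
  · rw [pdfTerm_eq hR hR0 hx]
    exact mul_nonneg (psi_nonneg hR k)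
      (gammaPDFReal_nonneg (by exact_mod_cast (by omega : 0 < R.rank + k)) (inv_pos.2 hl) x)
  · obtain ⟨m, hm⟩ : ∃ m, R.rank = m + 1 := ⟨R.rank - 1, by omega⟩
    have e : pdfTerm hR x k = psi hR k * ((minPosEig hR)⁻¹ * Real.exp (-(x / minPosEig hR)) *
        ((x / minPosEig hR) ^ (k + (R.rank - 1)) / (k + (R.rank - 1)).factorial)) := by
      rw [pdfTerm, hm, show m + 1 + k - 1 = k + m by omega, show m + 1 - 1 = m by omega,
        show ((m + 1 : ℕ) : ℝ) + k = (k + m : ℕ) + 1 by push_cast; ring,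
        Real.Gamma_nat_eq_factorial, show m + 1 + k = k + m + 1 by omega, div_pow, pow_succ]
      field_simp
    rw [e, mul_assoc (seriesFactor hR)⁻¹, mul_assoc (seriesFactor hR)⁻¹]
    exact mul_le_mul_of_nonneg_right (psi_le hR hR0 k) (by positivity)

/-- The mixture of gamma laws that describes the gain. -/
def gainMeasure : Measure ℝ :=
  Measure.sum fun k => ENNReal.ofReal (seriesFactor hR * psi hR k) •
    gammaMeasure (R.rank + k : ℕ) (minPosEig hR)⁻¹

theorem isProbabilityMeasure_gammaMeasure_rank_add (hR0 : R ≠ 0) (k : ℕ) :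
    IsProbabilityMeasure (gammaMeasure (R.rank + k : ℕ) (minPosEig hR)⁻¹) :=
  isProbabilityMeasure_gammaMeasure
    (by exact_mod_cast Nat.add_pos_left (rank_pos hR hR0) k) (inv_pos.2 (minPosEig_pos hR hR0))

theorem weight_nonneg (hR0 : R ≠ 0) (k : ℕ) : 0 ≤ seriesFactor hR * psi hR k :=
  mul_nonneg (seriesFactor_pos hR hR0).le (psi_nonneg hR k)

theorem isProbabilityMeasure_gainMeasure (hR0 : R ≠ 0) :
    IsProbabilityMeasure (gainMeasure hR) := by
  have := isProbabilityMeasure_gammaMeasure_rank_add hR hR0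
  refine ⟨?_⟩
  have h := hasSum_seriesFactor_mul_psi hR hR0
  simp only [gainMeasure, Measure.sum_apply _ MeasurableSet.univ, Measure.smul_apply, measure_univ,
    smul_eq_mul, mul_one]
  rw [← ENNReal.ofReal_tsum_of_nonneg (weight_nonneg hR hR0) h.summable, h.tsum_eq,
    ENNReal.ofReal_one]

theorem charFun_gainMeasure (hR0 : R ≠ 0) (t : ℝ) :
    charFun (gainMeasure hR) t = ∏ j : PosEigIndex hR, (1 / (1 - (posEig hR j * t : ℝ) * Complex.I)) := by
  have := isProbabilityMeasure_gainMeasure hR hR0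
  have hl := minPosEig_pos hR hR0
  have hl' : (minPosEig hR : ℂ) ≠ 0 := by exact_mod_cast hl.ne'
  have hne : ∀ s : ℝ, 1 - (s : ℂ) * Complex.I ≠ 0 := fun s h => by
    simpa using congrArg Complex.re h
  -- The characteristic function at `t` of the exponential law of mean `λ_min`. Its denominator has
  -- real part one, whence `‖u‖ ≤ 1`.
  set u : ℂ := 1 / (1 - (minPosEig hR * t : ℝ) * Complex.I) with hu
  have hu1 : ‖u‖ ≤ 1 := by
    rw [hu, norm_div, norm_one]
    refine div_le_one_of_le₀ ?_ (norm_nonneg _)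
    simpa using Complex.abs_re_le_norm (1 - ((minPosEig hR * t : ℝ) : ℂ) * Complex.I)
  have hint : Integrable (fun x : ℝ => Complex.exp (t * x * Complex.I)) (gainMeasure hR) := by
    refine Integrable.of_bound (by fun_prop) 1 (ae_of_all _ fun x => ?_)
    rw [← Complex.ofReal_mul, Complex.norm_exp_ofReal_mul_I]
  rw [charFun_apply_real]
  have hs := hasSum_integral_measure hint
  refine hs.unique ?_
  have hterm : ∀ k, ∫ x : ℝ, Complex.exp (t * x * Complex.I)
      ∂(ENNReal.ofReal (seriesFactor hR * psi hR k) •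
        gammaMeasure (R.rank + k : ℕ) (minPosEig hR)⁻¹) =
      seriesFactor hR * u ^ R.rank * (psi hR k * u ^ k) := fun k => by
    rw [integral_smul_measure, ← charFun_apply_real,
      charFun_gammaMeasure_natCast (Nat.add_pos_left (rank_pos hR hR0) k) (inv_pos.2 hl),
      ENNReal.toReal_ofReal (weight_nonneg hR hR0 k), Complex.real_smul]
    have : (((minPosEig hR)⁻¹ : ℝ) : ℂ) / (((minPosEig hR)⁻¹ : ℝ) - t * Complex.I) = u := by
      rw [hu]
      have h1 := hne (minPosEig hR * t)
      push_cast at h1 ⊢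
      have h2 : (minPosEig hR : ℂ)⁻¹ - t * Complex.I ≠ 0 := fun h => h1 <| by
        linear_combination (minPosEig hR : ℂ) * h - mul_inv_cancel₀ hl'
      rw [div_eq_div_iff h2 h1]
      field_simp
    rw [this]
    push_cast
    ring
  simp_rw [hterm]
  have e : seriesFactor hR * u ^ R.rank *
      ∏ j : PosEigIndex hR, (1 - (1 - minPosEig hR / posEig hR j : ℝ) * u)⁻¹ =
      ∏ j : PosEigIndex hR, (1 / (1 - (posEig hR j * t : ℝ) * Complex.I)) := by
    rw [seriesFactor_eq_prod, ← card_posEigIndex hR, ← Finset.card_univ, ← Finset.prod_const]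
    push_cast
    rw [← Finset.prod_mul_distrib, ← Finset.prod_mul_distrib]
    refine Finset.prod_congr rfl fun j _ => ?_
    have h2 : (posEig hR j : ℂ) ≠ 0 := by exact_mod_cast (posEig_pos hR j).ne'
    have h3 := hne (minPosEig hR * t)
    have h4 := hne (posEig hR j * t)
    -- The key identity: it turns each geometric factor in `u` into the characteristic function of
    -- one `λ_j E_j`, leaving the factors `λ_min / λ_j` and `u`.
    have h5 : 1 - (1 - (minPosEig hR : ℂ) / posEig hR j) * u =
        minPosEig hR / posEig hR j * u * (1 - (posEig hR j * t : ℝ) * Complex.I) := by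
      rw [hu]
      field_simp
      push_cast
      ring
    have h6 : u ≠ 0 := one_div_ne_zero h3
    rw [h5]
    push_cast at h4 ⊢
    field_simp
  rw [← e]
  exact (hasSum_psi hR hR0 hu1).mul_left _

/-- Links the real series to an `ENNReal` sum of gamma densities, where measurability and the
exchange of sum and integral need no convergence argument. -/
theorem ofReal_gainPDF (hR0 : R ≠ 0) (x : ℝ) :
    ENNReal.ofReal (gainPDF hR x) = ∑' k, ENNReal.ofReal (seriesFactor hR * psi hR k) *
      gammaPDF (R.rank + k : ℕ) (minPosEig hR)⁻¹ x := by
  simp only [gammaPDF, gainPDF]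
  split_ifs with hx
  · rw [← tsum_mul_left, ENNReal.ofReal_tsum_of_nonneg _ ((summable_pdfTerm hR hR0 hx).mul_left _)]
    · refine tsum_congr fun k => ?_
      rw [← ENNReal.ofReal_mul (weight_nonneg hR hR0 k), pdfTerm_eq hR hR0 hx, mul_assoc]
    · intro k
      rw [pdfTerm_eq hR hR0 hx, ← mul_assoc]
      exact mul_nonneg (weight_nonneg hR hR0 k) (gammaPDFReal_nonneg
        (by exact_mod_cast Nat.add_pos_left (rank_pos hR hR0) k)
        (inv_pos.2 (minPosEig_pos hR hR0)) x)
  · simp [gammaPDFReal, hx]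

theorem measurable_ofReal_gainPDF (hR0 : R ≠ 0) :
    Measurable fun x => ENNReal.ofReal (gainPDF hR x) := by
  simp_rw [ofReal_gainPDF hR hR0]
  exact Measurable.tsum fun k => (measurable_gammaPDF _ _).const_mul _

theorem gainMeasure_eq_withDensity (hR0 : R ≠ 0) :
    gainMeasure hR = volume.withDensity fun x => ENNReal.ofReal (gainPDF hR x) := by
  simp_rw [gainMeasure, gammaMeasure, ← withDensity_smul _ (measurable_gammaPDF _ _)]
  rw [← withDensity_tsum fun k => (measurable_gammaPDF _ _).const_smul _]
  congr 1
  ext x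
  rw [tsum_apply (Pi.summable.2 fun _ => ENNReal.summable), ofReal_gainPDF hR hR0]
  rfl

theorem hasSum_cdf_gainMeasure (hR0 : R ≠ 0) {x : ℝ} (hx : 0 ≤ x) :
    HasSum (fun k => seriesFactor hR * cdfTerm hR (x / minPosEig hR) k)
      (cdf (gainMeasure hR) x) := by
  have := isProbabilityMeasure_gainMeasure hR hR0
  have hg := isProbabilityMeasure_gammaMeasure_rank_add hR hR0
  have hm : gainMeasure hR (Set.Iic x) = ∑' k, ENNReal.ofReal (seriesFactor hR * psi hR k) *
      gammaMeasure (R.rank + k : ℕ) (minPosEig hR)⁻¹ (Set.Iic x) := by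
    simp [gainMeasure, Measure.sum_apply _ measurableSet_Iic]
  rw [cdf_eq_real, measureReal_def, hm]
  have h := ENNReal.hasSum_toReal (hm ▸ measure_ne_top (gainMeasure hR) (Set.Iic x))
  rw [ENNReal.tsum_toReal_eq fun k => ENNReal.mul_ne_top ENNReal.ofReal_ne_top (measure_ne_top _ _)]
  convert h using 2 with k
  rw [ENNReal.toReal_mul, ENNReal.toReal_ofReal (weight_nonneg hR hR0 k), ← measureReal_def,
    ← cdf_eq_real, cdf_gammaMeasure_eq_lowerGamma
      (by exact_mod_cast Nat.add_pos_left (rank_pos hR hR0) k)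
      (inv_pos.2 (minPosEig_pos hR hR0)) hx, cdfTerm, ← div_eq_inv_mul]
  push_cast
  rw [add_comm (k : ℝ)]
  ring

theorem cdf_gainMeasure_of_neg (hR0 : R ≠ 0) {x : ℝ} (hx : x < 0) :
    cdf (gainMeasure hR) x = 0 := by
  have := isProbabilityMeasure_gainMeasure hR hR0
  rw [cdf_eq_real, gainMeasure_eq_withDensity hR hR0, measureReal_def,
    withDensity_apply _ measurableSet_Iic, setLIntegral_congr_fun (g := fun _ => 0) measurableSet_Iic]
  · simp
  · intro y hy
    simp [gainPDF, not_le.2 (lt_of_le_of_lt hy hx)]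

end Mixture

/-! ### Diagonalising the complex Gaussian law. -/

section Rotation

variable {N : ℕ} {R : Matrix (Fin N) (Fin N) ℂ}

instance : IsProbabilityMeasure (stdComplexGaussianVec N) :=
  Measure.isProbabilityMeasure_map (by fun_prop)

theorem charFun_stdComplexGaussianVec (t : EuclideanSpace ℂ (Fin N)) :
    charFun (stdComplexGaussianVec N) t = Complex.exp (-(‖t‖ ^ 2 / 4 : ℝ)) := by
  rw [stdComplexGaussianVec]
  refine (charFun_pi t).trans ?_
  simp_rw [charFun_stdComplexGaussian, ← Complex.exp_sum, EuclideanSpace.norm_sq_eq]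
  push_cast
  rw [Finset.sum_neg_distrib, Finset.sum_div]

/-- Characteristic functions use the real inner product, while adjoints and eigenbases here use the
complex one. -/
theorem real_inner_eq_re (x y : EuclideanSpace ℂ (Fin N)) : inner ℝ x y = (inner ℂ x y).re := by
  rw [PiLp.inner_apply, PiLp.inner_apply]
  simp

theorem inner_toEuclideanCLM_left {A : Matrix (Fin N) (Fin N) ℂ} (hA : IsSelfAdjoint A)
    (x y : EuclideanSpace ℂ (Fin N)) :
    inner ℂ (Matrix.toEuclideanCLM (𝕜 := ℂ) A x) y =
      inner ℂ x (Matrix.toEuclideanCLM (𝕜 := ℂ) A y) := by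
  have h : IsSelfAdjoint (Matrix.toEuclideanCLM (𝕜 := ℂ) A) := hA.map _
  conv_lhs => rw [← h.adjoint_eq]
  rw [ContinuousLinearMap.adjoint_inner_left]

open scoped MatrixOrder in
theorem sq_norm_sqrt_apply (hR : R.PosSemidef) (t : EuclideanSpace ℂ (Fin N)) :
    ‖Matrix.toEuclideanCLM (𝕜 := ℂ) (CFC.sqrt R) t‖ ^ 2 =
      (inner ℂ t (Matrix.toEuclideanCLM (𝕜 := ℂ) R t)).re := by
  have hs : IsSelfAdjoint (CFC.sqrt R) := (CFC.sqrt_nonneg R).isSelfAdjoint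
  rw [← inner_self_eq_norm_sq (𝕜 := ℂ), inner_toEuclideanCLM_left hs, ← mul_apply_eq_comp,
    ← map_mul, CFC.sqrt_mul_sqrt_self R hR.nonneg]
  rfl

open scoped MatrixOrder in
-- Self-adjointness moves the square root of `R` onto `t`, and the squared norm of the result is the
-- quadratic form of `R`. Thus the law is computed without diagonalising the square root.
theorem charFun_complexGaussian (hR : R.PosSemidef) (t : EuclideanSpace ℂ (Fin N)) :
    charFun (complexGaussian 0 R) t =
      Complex.exp (-((inner ℂ t (Matrix.toEuclideanCLM (𝕜 := ℂ) R t)).re / 4 : ℝ)) := by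
  have hs : IsSelfAdjoint (CFC.sqrt R) := (CFC.sqrt_nonneg R).isSelfAdjoint
  rw [complexGaussian, charFun_apply, integral_map (by fun_prop) (by fun_prop)]
  simp_rw [zero_add, real_inner_eq_re, inner_toEuclideanCLM_left hs, ← real_inner_eq_re]
  rw [← charFun_apply, charFun_stdComplexGaussianVec, sq_norm_sqrt_apply hR, real_inner_eq_re]

theorem toEuclideanCLM_eigenvectorBasis (hR : R.PosSemidef) (i : Fin N) :
    Matrix.toEuclideanCLM (𝕜 := ℂ) R (hR.isHermitian.eigenvectorBasis i) =
      (hR.isHermitian.eigenvalues i : ℂ) • hR.isHermitian.eigenvectorBasis i := by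
  have h := hR.isHermitian.mulVec_eigenvectorBasis i
  apply (WithLp.ofLp_injective 2)
  rw [Matrix.ofLp_toEuclideanCLM, h]
  rfl

theorem re_inner_toEuclideanCLM_repr_symm (hR : R.PosSemidef) (s : EuclideanSpace ℂ (Fin N)) :
    (inner ℂ (hR.isHermitian.eigenvectorBasis.repr.symm s) (Matrix.toEuclideanCLM (𝕜 := ℂ) R
      (hR.isHermitian.eigenvectorBasis.repr.symm s))).re =
      ∑ i, hR.isHermitian.eigenvalues i * ‖s i‖ ^ 2 := by
  set b := hR.isHermitian.eigenvectorBasis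
  set t := b.repr.symm s with ht
  have hc : ∀ i, inner ℂ (b i) t = s i := fun i => by
    rw [← b.repr_apply_apply, ht, LinearIsometryEquiv.apply_symm_apply]
  rw [← b.sum_inner_mul_inner, Complex.re_sum]
  refine Finset.sum_congr rfl fun i _ => ?_
  rw [← inner_toEuclideanCLM_left hR.isHermitian, toEuclideanCLM_eigenvectorBasis hR, inner_smul_left,
    hc, ← inner_conj_symm, hc, Complex.conj_ofReal, mul_left_comm, Complex.re_ofReal_mul,
    Complex.conj_mul']
  norm_cast

/-- In an eigenbasis of the covariance matrix, the coordinates of a complex Gaussian vector are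
independent complex Gaussian variables whose variances are the eigenvalues. -/
theorem map_repr_complexGaussian (hR : R.PosSemidef) :
    (complexGaussian 0 R).map (fun x i => hR.isHermitian.eigenvectorBasis.repr x i) =
      Measure.pi fun i => stdComplexGaussian.map (√(hR.isHermitian.eigenvalues i) • ·) := by
  set b := hR.isHermitian.eigenvectorBasis with hb
  have hpc : IsProbabilityMeasure (complexGaussian 0 R) :=
    Measure.isProbabilityMeasure_map (by fun_prop)
  have hp1 : ∀ i, IsProbabilityMeasure
      (stdComplexGaussian.map (√(hR.isHermitian.eigenvalues i) • ·)) := fun i =>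
    Measure.isProbabilityMeasure_map (by fun_prop)
  have hp2 : IsProbabilityMeasure ((complexGaussian 0 R).map (fun x i => b.repr x i)) :=
    Measure.isProbabilityMeasure_map (by fun_prop)
  refine (charFun_eq_pi_iff).1 fun s => ?_
  rw [Measure.map_map (by fun_prop) (by fun_prop), charFun_apply,
    integral_map (by fun_prop) (by fun_prop)]
  -- The coordinate map is unitary, so pairing coordinates with `s` is pairing `x` with the preimage
  -- of `s`.
  have e : ∀ x, (inner ℝ ((WithLp.toLp 2 ∘ fun x i => b.repr x i) x) s : ℝ) =
      inner ℝ x (b.repr.symm s) := fun x => by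
    rw [real_inner_eq_re, real_inner_eq_re, ← b.repr.inner_map_map x,
      LinearIsometryEquiv.apply_symm_apply]
    rfl
  simp_rw [e]
  rw [← charFun_apply, charFun_complexGaussian hR, re_inner_toEuclideanCLM_repr_symm hR]
  simp_rw [charFun_map_smul, charFun_stdComplexGaussian, ← Complex.exp_sum, norm_smul, mul_pow,
    Real.norm_eq_abs, sq_abs, Real.sq_sqrt (hR.eigenvalues_nonneg _)]
  push_cast
  rw [Finset.sum_neg_distrib, Finset.sum_div]

end Rotation

/-! ### The law of the gain and the outage event. -/

/-- The squared norm of a complex Gaussian vector is a combination of independent unit exponential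
variables weighted by the positive eigenvalues of the covariance matrix. -/
theorem exists_exponential_representation {Ω : Type*} [MeasurableSpace Ω] {P : Measure Ω}
    [IsProbabilityMeasure P] {N : ℕ} {R : Matrix (Fin N) (Fin N) ℂ} (hR : R.PosSemidef)
    {h : Ω → EuclideanSpace ℂ (Fin N)} (hh : HasLaw h (complexGaussian 0 R) P) :
    ∃ E : PosEigIndex hR → Ω → ℝ,
      (∀ i, HasLaw (E i) (expMeasure 1) P) ∧ iIndepFun E P ∧
      ∀ᵐ ω ∂P, ‖h ω‖ ^ 2 = ∑ i, posEig hR i * E i ω := by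
  set b := hR.isHermitian.eigenvectorBasis
  set lam := hR.isHermitian.eigenvalues
  have hm : AEMeasurable h P := hh.aemeasurable
  let U : Fin N → Ω → ℂ := fun i ω => b.repr (h ω) i
  have hU : ∀ i, AEMeasurable (U i) P := fun i => by
    have : Measurable fun x : EuclideanSpace ℂ (Fin N) => b.repr x i := by fun_prop
    exact this.comp_aemeasurable hm
  have hp1 : ∀ i, IsProbabilityMeasure (stdComplexGaussian.map (√(lam i) • ·)) := fun i =>
    Measure.isProbabilityMeasure_map (by fun_prop)
  have hjoint : P.map (fun ω i => U i ω) =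
      Measure.pi fun i => stdComplexGaussian.map (√(lam i) • ·) := by
    rw [← map_repr_complexGaussian hR, ← hh.map_eq,
      AEMeasurable.map_map_of_aemeasurable (by fun_prop) hm]
    rfl
  have hmarg : ∀ i, P.map (U i) = stdComplexGaussian.map (√(lam i) • ·) := fun i => by
    rw [← (measurePreserving_eval (fun i => stdComplexGaussian.map (√(lam i) • ·)) i).map_eq,
      ← hjoint, AEMeasurable.map_map_of_aemeasurable (measurable_pi_apply i).aemeasurable
        (aemeasurable_pi_lambda _ hU)]
    rfl
  have hind : iIndepFun U P := by
    rw [iIndepFun_iff_map_fun_eq_pi_map hU, hjoint]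
    simp_rw [hmarg]
  -- Each `E i` is the squared modulus of an eigencoordinate divided by its variance, so it lives on
  -- the given probability space.
  refine ⟨fun i ω => ‖U i.1 ω‖ ^ 2 / lam i.1, fun i => ⟨by fun_prop, ?_⟩, ?_, ?_⟩
  · have hf : Measurable fun z : ℂ => ‖z‖ ^ 2 / lam i.1 := by fun_prop
    have e : (fun ω => ‖U i.1 ω‖ ^ 2 / lam i.1) = (fun z : ℂ => ‖z‖ ^ 2 / lam i.1) ∘ U i.1 := rfl
    beta_reduce
    rw [e, ← AEMeasurable.map_map_of_aemeasurable hf.aemeasurable (hU i.1), hmarg,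
      Measure.map_map hf (by fun_prop), ← map_sq_norm_stdComplexGaussian]
    congr 1
    ext z
    have hi : 0 < lam i.1 := i.2
    simp only [Function.comp_apply, norm_smul, mul_pow, Real.norm_eq_abs, sq_abs,
      Real.sq_sqrt hi.le]
    field_simp
  · exact (hind.precomp Subtype.val_injective).comp (fun i z => ‖z‖ ^ 2 / lam i.1)
      fun i => by fun_prop
  -- Coordinates with eigenvalue zero are standard Gaussians scaled by `0`, hence vanish almost
  -- surely. This is why the identity holds only almost everywhere and involves positive eigenvalues
  -- alone.
  · have hzero : ∀ i, lam i = 0 → ∀ᵐ ω ∂P, U i ω = 0 := fun i hi => by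
      have h0 : ∀ᵐ z ∂(P.map (U i)), z = 0 := by
        rw [hmarg, hi, ae_map_iff (p := fun z : ℂ => z = 0) (by fun_prop)
          (measurableSet_singleton 0)]
        simp
      exact ae_of_ae_map (hU i) h0
    have hall : ∀ᵐ ω ∂P, ∀ i, lam i = 0 → U i ω = 0 := by
      rw [ae_all_iff]
      intro i
      by_cases hi : lam i = 0
      · filter_upwards [hzero i hi] with ω hω _ using hω
      · exact ae_of_all _ fun ω h => absurd h hi
    filter_upwards [hall] with ω hω
    rw [← b.repr.norm_map, EuclideanSpace.norm_sq_eq]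
    have h1 : ∀ i, ‖b.repr (h ω) i‖ ^ 2 ≠ 0 → 0 < lam i := fun i hi => by
      refine lt_of_le_of_ne (hR.eigenvalues_nonneg i) fun h0 => hi ?_
      have : b.repr (h ω) i = 0 := hω i h0.symm
      rw [this]
      simp
    rw [← Finset.sum_filter_of_ne (p := fun i => 0 < lam i) fun i _ hi => h1 i hi,
      Finset.sum_subtype (p := fun i => 0 < lam i) _ (by simp)]
    refine Finset.sum_congr rfl fun i _ => ?_
    exact (mul_div_cancel₀ _ (ne_of_gt i.2)).symm

/-- Both laws have characteristic function `∏ 1 / (1 - i λ_j t)`: the gain by independence of the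
exponentials, the mixture by `charFun_gainMeasure`. -/
theorem map_sq_norm_eq_gainMeasure {Ω : Type*} [MeasurableSpace Ω] {P : Measure Ω}
    [IsProbabilityMeasure P] {N : ℕ} {R : Matrix (Fin N) (Fin N) ℂ} (hR : R.PosSemidef)
    (hR0 : R ≠ 0) {h : Ω → EuclideanSpace ℂ (Fin N)} (hh : HasLaw h (complexGaussian 0 R) P) :
    P.map (fun ω => ‖h ω‖ ^ 2) = gainMeasure hR := by
  obtain ⟨E, hE, hind, hsum⟩ := exists_exponential_representation hR hh
  have := isProbabilityMeasure_gainMeasure hR hR0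
  have hm : AEMeasurable h P := hh.aemeasurable
  have hmE : ∀ i, AEMeasurable (fun ω => posEig hR i * E i ω) P := fun i =>
    (hE i).aemeasurable.const_mul _
  have : IsProbabilityMeasure (P.map fun ω => ‖h ω‖ ^ 2) :=
    Measure.isProbabilityMeasure_map (by fun_prop)
  have hind' : iIndepFun (fun i ω => posEig hR i * E i ω) P :=
    hind.comp (fun i x => posEig hR i * x) fun i => by fun_prop
  refine Measure.ext_of_charFun (funext fun t => ?_)
  rw [Measure.map_congr hsum, hind'.charFun_map_fun_sum_eq_prod hmE, charFun_gainMeasure hR hR0,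
    Finset.prod_apply]
  refine Finset.prod_congr rfl fun i _ => ?_
  rw [charFun_map_mul_comp (hE i).aemeasurable, (hE i).map_eq, charFun_expMeasure_one]

theorem logb_one_add_snr_lt_iff {N : ℕ} {p σ rate : ℝ} (hp : 0 < p) (hσ : 0 < σ)
    (v : EuclideanSpace ℂ (Fin N)) :
    Real.logb 2 (1 + snr p σ v) < rate ↔ ‖v‖ ^ 2 < ((2 : ℝ) ^ rate - 1) / (p / σ ^ 2) := by
  have hc : 0 < p / σ ^ 2 := by positivity
  rw [Real.logb_lt_iff_lt_rpow one_lt_two (by unfold snr; positivity), lt_div_iff₀' hc, snr,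
    lt_sub_iff_add_lt']

end MISO

end

theorem mainTheorem4 {Ω : Type*} [MeasurableSpace Ω] (P : Measure Ω) [IsProbabilityMeasure P]
    (N : ℕ) (R : Matrix (Fin N) (Fin N) ℂ) (hR : R.PosSemidef) (hR0 : R ≠ 0)
    (h : Ω → EuclideanSpace ℂ (Fin N)) (hh : HasLaw h (MISO.complexGaussian 0 R) P) :
    -- the gain is a sum of independent unit exponentials weighted by the positive eigenvalues
    (∃ E : MISO.PosEigIndex hR → Ω → ℝ,
      (∀ i, HasLaw (E i) (expMeasure 1) P) ∧ iIndepFun E P ∧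
      ∀ᵐ ω ∂P, ‖h ω‖ ^ 2 = ∑ i, MISO.posEig hR i * E i ω) ∧
    -- density
    (∀ x : ℝ, 0 ≤ x → Summable (MISO.pdfTerm hR x)) ∧
    HasPDF (fun ω => ‖h ω‖ ^ 2) P volume ∧
    (pdf (fun ω => ‖h ω‖ ^ 2) P volume
      =ᵐ[volume] fun x => ENNReal.ofReal (MISO.gainPDF hR x)) ∧
    -- distribution function
    (∀ x : ℝ, x < 0 → cdf (P.map fun ω => ‖h ω‖ ^ 2) x = 0) ∧
    (∀ x : ℝ, 0 ≤ x →
      Summable (MISO.cdfTerm hR (x / MISO.minPosEig hR)) ∧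
      cdf (P.map fun ω => ‖h ω‖ ^ 2) x =
        MISO.seriesFactor hR * ∑' k : ℕ, MISO.cdfTerm hR (x / MISO.minPosEig hR) k) ∧
    -- outage probability
    (∀ p σ rate : ℝ, 0 < p → 0 < σ → 0 ≤ rate →
      MISO.outageProb P h p σ rate =
        MISO.seriesFactor hR *
          ∑' k : ℕ, MISO.cdfTerm hR
            (((2 : ℝ) ^ rate - 1) / (p / σ ^ 2 * MISO.minPosEig hR)) k) := by
  have hm : AEMeasurable h P := hh.aemeasurable
  have hlaw := MISO.map_sq_norm_eq_gainMeasure hR hR0 hh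
  have hdens := hlaw.trans (MISO.gainMeasure_eq_withDensity hR hR0)
  have hmeas := MISO.measurable_ofReal_gainPDF hR hR0
  have hpdf : HasPDF (fun ω => ‖h ω‖ ^ 2) P volume :=
    hasPDF_of_map_eq_withDensity (by fun_prop) _ hmeas.aemeasurable hdens
  -- A nonzero factor can be cancelled, so summability of the weighted series passes to the
  -- `cdfTerm` series.
  have hsf := (MISO.seriesFactor_pos hR hR0).ne'
  have hcdf : ∀ x : ℝ, 0 ≤ x →
      Summable (MISO.cdfTerm hR (x / MISO.minPosEig hR)) ∧
      cdf (P.map fun ω => ‖h ω‖ ^ 2) x =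
        MISO.seriesFactor hR * ∑' k : ℕ, MISO.cdfTerm hR (x / MISO.minPosEig hR) k := by
    intro x hx
    have hs := MISO.hasSum_cdf_gainMeasure hR hR0 hx
    refine ⟨(summable_mul_left_iff hsf).1 hs.summable, ?_⟩
    rw [hlaw, ← hs.tsum_eq, tsum_mul_left]
  refine ⟨MISO.exists_exponential_representation hR hh,
    fun x hx => MISO.summable_pdfTerm hR hR0 hx, hpdf,
    (pdf.eq_of_map_eq_withDensity _ hmeas.aemeasurable).1 hdens, fun x hx => ?_, hcdf, ?_⟩
  · rw [hlaw, MISO.cdf_gainMeasure_of_neg hR hR0 hx]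
  · intro p σ rate hp hσ hrate
    have hx : 0 ≤ ((2 : ℝ) ^ rate - 1) / (p / σ ^ 2) :=
      div_nonneg (sub_nonneg.2 (Real.one_le_rpow one_le_two hrate)) (by positivity)
    have : IsProbabilityMeasure (P.map fun ω => ‖h ω‖ ^ 2) :=
      Measure.isProbabilityMeasure_map (by fun_prop)
    -- Outage is a strict inequality whereas the distribution function uses a weak one; a law with a
    -- density has no atoms, so the two probabilities agree.
    have hatom : NullSingletonClass (P.map fun ω => ‖h ω‖ ^ 2) := by
      rw [hdens]
      infer_instance
    rw [← div_div, ← (hcdf _ hx).2, cdf_eq_real, MISO.outageProb,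
      ← measureReal_congr Iio_ae_eq_Iic, measureReal_def, measureReal_def,
      Measure.map_apply_of_aemeasurable (by fun_prop) measurableSet_Iio]
    simp_rw [MISO.logb_one_add_snr_lt_iff hp hσ]
    rfl
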